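/- Let $q$ be a prime power, let $F$ be the field with $q^2$ elements, and let $A=(a_{ij})$ be a non-singular Hermitian $3\times 3$ matrix over $F$ (that is, $a_{ji}=a_{ij}^{\,q}$ for all $i,j$, and $\det A\neq 0$). Let $\mathcal{H}$ be the non-singular Hermitian variety $\sum_{i,j}a_{ij}X_iX_j^{\,q}=0$ in the projective plane $\mathrm{PG}(2,q^2)$, and let $\mathcal{U}$ be the corresponding classical (Hermitian) unital: its points are the points of $\mathcal{H}$, its blocks are the secant lines of $\mathcal{H}$ (the lines containing at least two points of $\mathcal{H}$), and incidence is that of the plane. An Erdős–Ko–Rado set on $\mathcal{U}$ is a set of pairwise intersecting blocks (any two of them have a common point of $\mathcal{U}$); it is maximal if it is not properly contained in another Erdős–Ko–Rado set. A point-pencil is the set of all blocks through a fixed point $P$ of $\mathcal{U}$. A triangle is a set consisting of a block $B$ and all the blocks through $P$ that meet $B$, where $P$ is a point of $\mathcal{U}$ not on $B$. Then there are precisely two types of maximal Erdős–Ko–Rado sets on $\mathcal{U}$, the point-pencil and the triangle: a set of blocks of $\mathcal{U}$ is a maximal Erdős–Ko–Rado set if and only if it is a point-pencil or a triangle; both point-pencils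 and triangles exist; and no set of blocks is both a point-pencil and a triangle. -/

import Mathlib

open scoped LinearAlgebra.Projectivization Matrix

/-- An incidence structure with point set `P` and block set `B`. -/
structure IncidenceStructure (P : Type*) (B : Type*) where
  /-- `inc p b` says that the point `p` is on the block `b`. -/
  inc : P → B → Prop

namespace IncidenceStructure

variable {P B : Type*} (D : IncidenceStructure P B)

/-- Two blocks meet if they have a point in common. -/
def Meet (b c : B) : Prop := ∃ p : P, D.inc p b ∧ D.inc p c

/-- An Erdős–Ko–Rado set: a set of pairwise intersecting blocks. -/
def IsEKR (S : Set B) : Prop := S.Pairwise D.Meet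

/-- An Erdős–Ko–Rado set that is not properly contained in another one. -/
def IsMaximalEKR (S : Set B) : Prop := Maximal D.IsEKR S

/-- The point-pencil with vertex `p`: all blocks through `p`. -/
def pointPencil (p : P) : Set B := {b | D.inc p b}

/-- The triangle on a point `p` and a block `b`: the block `b` together with all the blocks through
`p` that meet `b`. It is considered for `p` not on `b` only. -/
def triangle (p : P) (b : B) : Set B := {b} ∪ {c | D.inc p c ∧ D.Meet c b}

/-- `S` is a point-pencil. -/
def IsPointPencil (S : Set B) : Prop := ∃ p : P, S = D.pointPencil p

/-- `S` is a triangle. -/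
def IsTriangle (S : Set B) : Prop := ∃ (p : P) (b : B), ¬ D.inc p b ∧ S = D.triangle p b

end IncidenceStructure

section Hermitian

variable {F : Type*} [Field F]

/-- A non-singular Hermitian `3 × 3` matrix over a field `F` with `q ^ 2` elements, with respect to
the involution `x ↦ x ^ q` of `F`. -/
structure IsNonsingularHermitian (q : ℕ) (A : Matrix (Fin 3) (Fin 3) F) : Prop where
  transpose_eq : Aᵀ = A.map (fun x => x ^ q)
  det_ne_zero : A.det ≠ 0

/-- The value `∑ i j, x i * A i j * x j ^ q` of the Hermitian form with matrix `A` at `(x, x)`. -/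
def hermitianValue (q : ℕ) (A : Matrix (Fin 3) (Fin 3) F) (x : Fin 3 → F) : F :=
  ∑ i, ∑ j, x i * A i j * x j ^ q

theorem hermitianValue_smul (q : ℕ) (A : Matrix (Fin 3) (Fin 3) F) (c : F) (x : Fin 3 → F) :
    hermitianValue q A (c • x) = c ^ (q + 1) * hermitianValue q A x := by
  simp only [hermitianValue, Finset.mul_sum, Pi.smul_apply, smul_eq_mul, mul_pow]
  refine Finset.sum_congr rfl fun i _ => Finset.sum_congr rfl fun j _ => ?_
  ring

/-- The Hermitian variety in the projective plane over `F` given by the matrix `A`: the points all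
of whose coordinate vectors satisfy the equation. -/
def hermitianVariety (q : ℕ) (A : Matrix (Fin 3) (Fin 3) F) : Set (ℙ F (Fin 3 → F)) :=
  {p | ∀ x ∈ p.submodule, hermitianValue q A x = 0}

/-- One coordinate vector suffices to decide membership. -/
theorem mk_mem_hermitianVariety (q : ℕ) (A : Matrix (Fin 3) (Fin 3) F) (x : Fin 3 → F)
    (hx : x ≠ 0) :
    Projectivization.mk F x hx ∈ hermitianVariety q A ↔ hermitianValue q A x = 0 := by
  simp only [hermitianVariety, Set.mem_ofPred_eq, Projectivization.submodule_mk]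
  refine ⟨fun h => h x (Submodule.mem_span_singleton_self x), fun h y hy => ?_⟩
  obtain ⟨c, rfl⟩ := Submodule.mem_span_singleton.mp hy
  rw [hermitianValue_smul, h, mul_zero]

/-- The points of the projective plane over `F` on the line given by the subspace `L`. -/
def linePoints (L : Submodule F (Fin 3 → F)) : Set (ℙ F (Fin 3 → F)) :=
  {p | p.submodule ≤ L}

/-- `L` is a secant line of the point set `H`: a projective line (a two-dimensional subspace) that
contains at least two points of `H`. -/
def IsSecantLine (H : Set (ℙ F (Fin 3 → F))) (L : Submodule F (Fin 3 → F)) : Prop :=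
  Module.finrank F L = 2 ∧ (linePoints L ∩ H).Nontrivial

/-- The classical (Hermitian) unital of the Hermitian variety given by `A`: its points are the
points of the variety, its blocks are the secant lines, and incidence is that of the plane. -/
def classicalUnital (q : ℕ) (A : Matrix (Fin 3) (Fin 3) F) :
    IncidenceStructure {p // p ∈ hermitianVariety q A}
      {L // IsSecantLine (hermitianVariety q A) L} where
  inc p L := p.1 ∈ linePoints L.1

end Hermitian

/-! The Hermitian unital contains no O'Nan configuration (four blocks meeting pairwise in six
points), and combinatorics does the rest.

Let `S` be an Erdős–Ko–Rado set in no pencil. It contains three blocks forming the sides of a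
triangle, and every block of `S` passes through a vertex, else it completes an O'Nan configuration.
Two further blocks of `S` through different vertices would form one with two of the sides. So all
blocks of `S` but one side pass through the vertex opposite to that side (`subset_triangle`).
Maximality follows because no pencil or triangle lies in a different pencil or triangle.

For the geometry, scale the vertices `x`, `y`, `z` so that a functional vanishing on the fourth line
takes the value 1 on them. The other three points are then `x - y`, `y - z`, `z - x`. Their isotropy
makes the Gram matrix of `x`, `y`, `z` alternating of odd order, hence singular
(`IsHermitianForm.no_onan`). -/

namespace IncidenceStructure

/-! ### Erdős–Ko–Rado sets in linear spaces without O'Nan configurations -/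

variable {P B : Type*} {D : IncidenceStructure P B}

/-- A linear space with blocks of size at least three, in which not all points are collinear, every
point off a block is on a block missing it, and four blocks in general position never meet pairwise
(there are no O'Nan configurations). -/
structure IsONanFree (D : IncidenceStructure P B) : Prop where
  exists_join : ∀ p r : P, p ≠ r → ∃ b, D.inc p b ∧ D.inc r b
  eq_of_inc : ∀ (p r : P) (b c : B), p ≠ r → D.inc p b → D.inc r b → D.inc p c → D.inc r c → b = c
  three_points : ∀ b : B, ∃ p r s : P, D.inc p b ∧ D.inc r b ∧ D.inc s b ∧ p ≠ r ∧ p ≠ s ∧ r ≠ s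
  exists_not_meet : ∀ (p : P) (b : B), ¬ D.inc p b → ∃ c, D.inc p c ∧ ¬ D.Meet c b
  exists_not_inc : ∃ (p : P) (b : B), ¬ D.inc p b
  no_onan : ∀ (b₁ b₂ b₃ b₄ : B) (p₁₂ p₁₃ p₂₃ : P),
    D.inc p₁₂ b₁ → D.inc p₁₂ b₂ → ¬ D.inc p₁₂ b₃ →
    D.inc p₁₃ b₁ → D.inc p₁₃ b₃ → ¬ D.inc p₁₃ b₂ →
    D.inc p₂₃ b₂ → D.inc p₂₃ b₃ → ¬ D.inc p₂₃ b₁ →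
    D.Meet b₁ b₄ → D.Meet b₂ b₄ → D.Meet b₃ b₄ →
    D.inc p₁₂ b₄ ∨ D.inc p₁₃ b₄ ∨ D.inc p₂₃ b₄

theorem Meet.symm {b c : B} (h : D.Meet b c) : D.Meet c b :=
  let ⟨p, hb, hc⟩ := h
  ⟨p, hc, hb⟩

theorem isEKR_pointPencil (p : P) : D.IsEKR (D.pointPencil p) :=
  fun _ hb _ hc _ => ⟨p, hb, hc⟩

theorem isEKR_triangle (p : P) (b : B) : D.IsEKR (D.triangle p b) := by
  rintro c (rfl | ⟨hc, hcb⟩) d (rfl | ⟨hd, hdb⟩) hne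
  · exact absurd rfl hne
  · exact hdb.symm
  · exact hcb
  · exact ⟨p, hc, hd⟩

theorem subset_triangle_of_forall {S : Set B} (hS : D.IsEKR S) {p : P} {b : B} (hb : b ∈ S)
    (h : ∀ d ∈ S, d ≠ b → D.inc p d) : S ⊆ D.triangle p b := by
  intro d hd
  by_cases hdb : d = b
  · exact Or.inl hdb
  · exact Or.inr ⟨h d hd hdb, hS hd hb hdb⟩

namespace IsONanFree

variable (hD : D.IsONanFree)
include hD

theorem meet_self (b : B) : D.Meet b b :=
  let ⟨p, _, _, hp, _⟩ := hD.three_points b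
  ⟨p, hp, hp⟩

theorem meet_of_isEKR {S : Set B} (hS : D.IsEKR S) {b c : B} (hb : b ∈ S) (hc : c ∈ S) :
    D.Meet b c := by
  rcases eq_or_ne b c with rfl | hne
  · exact hD.meet_self b
  · exact hS hb hc hne

/-- In a triangle of blocks, there are no pairwise meeting further blocks through two different
vertices. -/
theorem not_two_transversals {b₁ b₂ b₃ d e : B} {p₁₂ p₁₃ p₂₃ : P}
    (h₁ : D.inc p₁₂ b₁) (h₂ : D.inc p₁₂ b₂) (h₃ : ¬ D.inc p₁₂ b₃)
    (h₄ : D.inc p₁₃ b₁) (h₅ : D.inc p₁₃ b₃) (h₆ : ¬ D.inc p₁₃ b₂)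
    (h₇ : D.inc p₂₃ b₂) (h₈ : D.inc p₂₃ b₃)
    (hd : D.inc p₁₂ d) (hd₁ : d ≠ b₁) (hd₂ : d ≠ b₂) (he : D.inc p₁₃ e) (he₁ : e ≠ b₁) (he₃ : e ≠ b₃)
    (hde : D.Meet d e) (hd₃ : D.Meet d b₃) (he₂ : D.Meet e b₂) : False := by
  obtain ⟨r, hrd, hr₃⟩ := hd₃
  obtain ⟨s, hse, hs₂⟩ := he₂
  have n₁ : p₁₂ ≠ p₁₃ := fun h => h₃ (h ▸ h₅)
  have n₂ : p₁₂ ≠ p₂₃ := fun h => h₃ (h ▸ h₈)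
  have n₃ : p₁₃ ≠ p₂₃ := fun h => h₆ (h ▸ h₇)
  have hr₁₂ : p₁₂ ≠ r := fun h => h₃ (h ▸ hr₃)
  have hdr : ¬ D.inc r b₂ := fun h => hd₂ (hD.eq_of_inc _ _ _ _ hr₁₂ hd hrd h₂ h)
  have hd₂₃ : ¬ D.inc p₂₃ d := fun h => hd₂ (hD.eq_of_inc _ _ _ _ n₂ hd h h₂ h₇)
  have he₁₂ : ¬ D.inc p₁₂ e := fun h => he₁ (hD.eq_of_inc _ _ _ _ n₁ h he h₁ h₄)
  have he₂₃ : ¬ D.inc p₂₃ e := fun h => he₃ (hD.eq_of_inc _ _ _ _ n₃ he h h₅ h₈)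
  -- The triangle with sides `d`, `b₂`, `b₃` and the fourth block `e` form an O'Nan configuration.
  rcases hD.no_onan d b₂ b₃ e p₁₂ r p₂₃ hd h₂ h₃ hrd hr₃ hdr h₇ h₈ hd₂₃ hde ⟨s, hs₂, hse⟩
    ⟨p₁₃, h₅, he⟩ with h | h | h
  · exact he₁₂ h
  · have hr : p₁₃ = r := by
      by_contra hne
      exact he₃ (hD.eq_of_inc _ _ _ _ hne he h h₅ hr₃)
    subst hr
    exact hd₁ (hD.eq_of_inc _ _ _ _ n₁ hd hrd h₁ h₄)
  · exact he₂₃ h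

/-- Three points of `b` give three blocks through `p`; at most one contains `r` and at most one is
`b'`. -/
theorem exists_inc_not_inc {p r : P} {b : B} (b' : B) (hb : ¬ D.inc p b) (hr : p ≠ r) :
    ∃ c, D.inc p c ∧ D.Meet c b ∧ ¬ D.inc r c ∧ c ≠ b' := by
  obtain ⟨x, y, z, hx, hy, hz, hxy, hxz, hyz⟩ := hD.three_points b
  have join : ∀ x, D.inc x b → ∃ c, D.inc p c ∧ D.inc x c := fun x hx =>
    hD.exists_join p x fun h => hb (h ▸ hx)
  have ne : ∀ x y c d, D.inc x b → D.inc y b → x ≠ y → D.inc x c → D.inc y d → D.inc p c →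
      c ≠ d := by
    rintro x y c d hx hy hxy hc hd hp rfl
    exact hb (hD.eq_of_inc _ _ _ _ hxy hc hd hx hy ▸ hp)
  obtain ⟨c, hpc, hxc⟩ := join x hx
  obtain ⟨d, hpd, hyd⟩ := join y hy
  obtain ⟨e, hpe, hze⟩ := join z hz
  have hcd := ne _ _ _ _ hx hy hxy hxc hyd hpc
  have hce := ne _ _ _ _ hx hz hxz hxc hze hpc
  have hde := ne _ _ _ _ hy hz hyz hyd hze hpd
  by_contra! H
  have hc := H c hpc ⟨x, hxc, hx⟩
  have hd := H d hpd ⟨y, hyd, hy⟩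
  have he := H e hpe ⟨z, hze, hz⟩
  have eq : ∀ c d, D.inc p c → D.inc p d → D.inc r c → D.inc r d → c = d :=
    fun c d h₁ h₂ h₃ h₄ => hD.eq_of_inc _ _ _ _ hr h₁ h₃ h₂ h₄
  by_cases h₁ : D.inc r c
  · have h₂ : ¬ D.inc r d := fun h => hcd (eq _ _ hpc hpd h₁ h)
    have h₃ : ¬ D.inc r e := fun h => hce (eq _ _ hpc hpe h₁ h)
    exact hde ((hd h₂).trans (he h₃).symm)
  · by_cases h₂ : D.inc r d
    · have h₃ : ¬ D.inc r e := fun h => hde (eq _ _ hpd hpe h₂ h)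
      exact hce ((hc h₁).trans (he h₃).symm)
    · exact hcd ((hc h₁).trans (hd h₂).symm)

theorem exists_block_not_inc (r : P) : ∃ b, ¬ D.inc r b := by
  obtain ⟨p, b, hpb⟩ := hD.exists_not_inc
  by_cases hr : D.inc r b
  · obtain ⟨c, -, -, hc, -⟩ := hD.exists_inc_not_inc b hpb (r := r) fun h => hpb (h ▸ hr)
    exact ⟨c, hc⟩
  · exact ⟨b, hr⟩

theorem not_triangle_subset_pointPencil {p r : P} {b : B} (hb : ¬ D.inc p b) :
    ¬ D.triangle p b ⊆ D.pointPencil r := by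
  intro h
  have hr : D.inc r b := h (Or.inl rfl)
  obtain ⟨c, hpc, hcb, hrc, -⟩ := hD.exists_inc_not_inc b hb (r := r) fun h => hb (h ▸ hr)
  exact hrc (h (Or.inr ⟨hpc, hcb⟩))

theorem eq_of_pointPencil_subset {p r : P} (h : D.pointPencil p ⊆ D.pointPencil r) : p = r := by
  by_contra hne
  obtain ⟨b, hb⟩ := hD.exists_block_not_inc p
  obtain ⟨c, hpc, -, hrc, -⟩ := hD.exists_inc_not_inc b hb hne
  exact hrc (h hpc)

/-- For `p = r` the pencil has a block missing `b`, which is where `exists_not_meet` is needed;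
otherwise it has a block other than `b` that avoids `r`. -/
theorem not_pointPencil_subset_triangle {p r : P} {b : B} (hb : ¬ D.inc r b) :
    ¬ D.pointPencil p ⊆ D.triangle r b := by
  intro h
  rcases eq_or_ne p r with rfl | hne
  · obtain ⟨c, hpc, hcb⟩ := hD.exists_not_meet p b hb
    rcases h hpc with rfl | ⟨-, h'⟩
    · exact hb hpc
    · exact hcb h'
  · obtain ⟨b', hb'⟩ := hD.exists_block_not_inc p
    obtain ⟨c, hpc, -, hrc, hcb⟩ := hD.exists_inc_not_inc b hb' hne
    rcases h hpc with h' | ⟨h', -⟩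
    · exact hcb h'
    · exact hrc h'

theorem eq_of_triangle_subset {p r : P} {b c : B} (hb : ¬ D.inc p b)
    (h : D.triangle p b ⊆ D.triangle r c) : p = r ∧ b = c := by
  have hpr : p = r := by
    by_contra hne
    obtain ⟨d, hpd, hdb, hrd, hdc⟩ := hD.exists_inc_not_inc c hb hne
    rcases h (Or.inr ⟨hpd, hdb⟩) with h' | ⟨h', -⟩
    · exact hdc h'
    · exact hrd h'
  subst hpr
  refine ⟨rfl, ?_⟩
  rcases h (Or.inl rfl) with h' | ⟨h', -⟩
  · exact h'
  · exact absurd h' hb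

/-- A set of pairwise meeting blocks that contains three non-concurrent blocks lies in a
triangle. -/
theorem subset_triangle {S : Set B} (hS : D.IsEKR S) {b₁ b₂ b₃ : B} (hb₁ : b₁ ∈ S) (hb₂ : b₂ ∈ S)
    (hb₃ : b₃ ∈ S) {p₁₂ p₁₃ p₂₃ : P}
    (h₁ : D.inc p₁₂ b₁) (h₂ : D.inc p₁₂ b₂) (h₃ : ¬ D.inc p₁₂ b₃)
    (h₄ : D.inc p₁₃ b₁) (h₅ : D.inc p₁₃ b₃) (h₆ : ¬ D.inc p₁₃ b₂)
    (h₇ : D.inc p₂₃ b₂) (h₈ : D.inc p₂₃ b₃) (h₉ : ¬ D.inc p₂₃ b₁) :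
    ∃ p b, ¬ D.inc p b ∧ S ⊆ D.triangle p b := by
  have meet : ∀ {b c : B}, b ∈ S → c ∈ S → D.Meet b c := fun hb hc => hD.meet_of_isEKR hS hb hc
  by_contra! H
  have key : ∀ {p b}, b ∈ S → ¬ D.inc p b → ∃ d ∈ S, d ≠ b ∧ ¬ D.inc p d := by
    intro p b hb hpb
    by_contra! h
    exact H p b hpb (subset_triangle_of_forall hS hb h)
  obtain ⟨d₃, m₃, n₃, i₃⟩ := key hb₃ h₃
  obtain ⟨d₂, m₂, n₂, i₂⟩ := key hb₂ h₆
  obtain ⟨d₁, m₁, n₁, i₁⟩ := key hb₁ h₉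
  have through : ∀ d ∈ S, D.inc p₁₂ d ∨ D.inc p₁₃ d ∨ D.inc p₂₃ d := fun d hd =>
    hD.no_onan b₁ b₂ b₃ d p₁₂ p₁₃ p₂₃ h₁ h₂ h₃ h₄ h₅ h₆ h₇ h₈ h₉ (meet hb₁ hd) (meet hb₂ hd)
      (meet hb₃ hd)
  have c₃₁ : d₃ ≠ b₁ := fun h => i₃ (h ▸ h₁)
  have c₃₂ : d₃ ≠ b₂ := fun h => i₃ (h ▸ h₂)
  have c₂₁ : d₂ ≠ b₁ := fun h => i₂ (h ▸ h₄)
  have c₂₃ : d₂ ≠ b₃ := fun h => i₂ (h ▸ h₅)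
  have c₁₂ : d₁ ≠ b₂ := fun h => i₁ (h ▸ h₇)
  have c₁₃ : d₁ ≠ b₃ := fun h => i₁ (h ▸ h₈)
  have t₁ : ∀ {d e}, d ∈ S → e ∈ S → D.inc p₁₂ d → D.inc p₁₃ e → d ≠ b₁ → d ≠ b₂ → e ≠ b₁ →
      e ≠ b₃ → False := fun hd he hpd hpe a₁ a₂ a₃ a₄ =>
    hD.not_two_transversals h₁ h₂ h₃ h₄ h₅ h₆ h₇ h₈ hpd a₁ a₂ hpe a₃ a₄ (meet hd he)
      (meet hd hb₃) (meet he hb₂)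
  have t₂ : ∀ {d e}, d ∈ S → e ∈ S → D.inc p₁₂ d → D.inc p₂₃ e → d ≠ b₁ → d ≠ b₂ → e ≠ b₂ →
      e ≠ b₃ → False := fun hd he hpd hpe a₁ a₂ a₃ a₄ =>
    hD.not_two_transversals h₂ h₁ h₃ h₇ h₈ h₉ h₄ h₅ hpd a₂ a₁ hpe a₃ a₄ (meet hd he)
      (meet hd hb₃) (meet he hb₁)
  have t₃ : ∀ {d e}, d ∈ S → e ∈ S → D.inc p₁₃ d → D.inc p₂₃ e → d ≠ b₁ → d ≠ b₃ → e ≠ b₂ →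
      e ≠ b₃ → False := fun hd he hpd hpe a₁ a₂ a₃ a₄ =>
    hD.not_two_transversals h₅ h₄ h₆ h₈ h₇ h₉ h₁ h₂ hpd a₂ a₁ hpe a₄ a₃ (meet hd he)
      (meet hd hb₂) (meet he hb₁)
  -- Each of `d₁`, `d₂`, `d₃` passes through a vertex, but no vertex is on all three, so two of them
  -- pass through different vertices.
  rcases through d₃ m₃ with h | h | h
  · exact i₃ h
  · rcases through d₂ m₂ with k | k | k
    · exact t₁ m₂ m₃ k h c₂₁ n₂ c₃₁ n₃
    · exact i₂ k
    · exact t₃ m₃ m₂ h k c₃₁ n₃ n₂ c₂₃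
  · rcases through d₁ m₁ with k | k | k
    · exact t₂ m₁ m₃ k h n₁ c₁₂ c₃₂ n₃
    · exact t₃ m₁ m₃ k h n₁ c₁₃ c₃₂ n₃
    · exact i₁ k

/-- Every Erdős–Ko–Rado set lies in a point-pencil or in a triangle. -/
theorem subset_pointPencil_or_triangle {S : Set B} (hS : D.IsEKR S) :
    (∃ p, S ⊆ D.pointPencil p) ∨ ∃ p b, ¬ D.inc p b ∧ S ⊆ D.triangle p b := by
  by_cases hsub : S.Subsingleton
  · left
    rcases hsub.eq_empty_or_singleton with rfl | ⟨b, rfl⟩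
    · obtain ⟨p, -⟩ := hD.exists_not_inc
      exact ⟨p, Set.empty_subset _⟩
    · obtain ⟨p, _, _, hp, -⟩ := hD.three_points b
      exact ⟨p, Set.singleton_subset_iff.mpr hp⟩
  · obtain ⟨b₁, hb₁, b₂, hb₂, hne⟩ := Set.not_subsingleton_iff.mp hsub
    obtain ⟨p₁₂, h₁, h₂⟩ := hS hb₁ hb₂ hne
    by_cases hall : ∀ b ∈ S, D.inc p₁₂ b
    · exact Or.inl ⟨p₁₂, hall⟩
    · right
      push Not at hall
      obtain ⟨b₃, hb₃, h₃⟩ := hall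
      obtain ⟨p₁₃, h₄, h₅⟩ := hD.meet_of_isEKR hS hb₁ hb₃
      obtain ⟨p₂₃, h₇, h₈⟩ := hD.meet_of_isEKR hS hb₂ hb₃
      have n₁ : p₁₂ ≠ p₁₃ := fun h => h₃ (h ▸ h₅)
      have n₂ : p₁₂ ≠ p₂₃ := fun h => h₃ (h ▸ h₈)
      exact hD.subset_triangle hS hb₁ hb₂ hb₃ h₁ h₂ h₃ h₄ h₅
        (fun h => hne (hD.eq_of_inc _ _ _ _ n₁ h₁ h₄ h₂ h)) h₇ h₈
        (fun h => hne (hD.eq_of_inc _ _ _ _ n₂ h₁ h h₂ h₇))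

theorem isMaximalEKR_iff {S : Set B} :
    D.IsMaximalEKR S ↔ D.IsPointPencil S ∨ D.IsTriangle S := by
  constructor
  · intro hS
    rcases hD.subset_pointPencil_or_triangle hS.prop with ⟨p, h⟩ | ⟨p, b, hb, h⟩
    · exact Or.inl ⟨p, hS.eq_of_subset (isEKR_pointPencil p) h⟩
    · exact Or.inr ⟨p, b, hb, hS.eq_of_subset (isEKR_triangle p b) h⟩
  · rintro (⟨p, rfl⟩ | ⟨p, b, hb, rfl⟩)
    · refine ⟨isEKR_pointPencil p, fun T hT hle => ?_⟩
      rcases hD.subset_pointPencil_or_triangle hT with ⟨r, h⟩ | ⟨r, c, hc, h⟩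
      · rwa [← hD.eq_of_pointPencil_subset (hle.trans h)] at h
      · exact absurd (hle.trans h) (hD.not_pointPencil_subset_triangle hc)
    · refine ⟨isEKR_triangle p b, fun T hT hle => ?_⟩
      rcases hD.subset_pointPencil_or_triangle hT with ⟨r, h⟩ | ⟨r, c, hc, h⟩
      · exact absurd (hle.trans h) (hD.not_triangle_subset_pointPencil hb)
      · obtain ⟨rfl, rfl⟩ := hD.eq_of_triangle_subset hb (hle.trans h)
        exact h

theorem exists_isPointPencil : ∃ S, D.IsPointPencil S :=
  let ⟨p, _⟩ := hD.exists_not_inc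
  ⟨_, p, rfl⟩

theorem exists_isTriangle : ∃ S, D.IsTriangle S :=
  let ⟨p, b, hb⟩ := hD.exists_not_inc
  ⟨_, p, b, hb, rfl⟩

theorem not_isPointPencil_and_isTriangle (S : Set B) :
    ¬ (D.IsPointPencil S ∧ D.IsTriangle S) := by
  rintro ⟨⟨r, rfl⟩, p, b, hb, h⟩
  exact hD.not_triangle_subset_pointPencil hb h.ge

end IsONanFree
end IncidenceStructure

/-! ### Planes in a three-dimensional space -/

section SubspaceLemmas

variable {F V : Type*} [Field F] [AddCommGroup V] [Module F V]

theorem Submodule.eq_top_of_finrank_two_lt (hV : Module.finrank F V = 3) {L M : Submodule F V}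
    (hL : Module.finrank F L = 2) (hLM : L ≤ M) {p : V} (hpM : p ∈ M) (hpL : p ∉ L) : M = ⊤ := by
  have : FiniteDimensional F V := Module.finite_of_finrank_eq_succ hV
  have hlt : L < M := lt_of_le_of_ne hLM fun h => hpL (h ▸ hpM)
  have h₁ := Submodule.finrank_lt_finrank_of_lt hlt
  have h₂ := Submodule.finrank_le M
  exact Submodule.eq_top_of_finrank_eq (by omega)

theorem Submodule.finrank_span_pair_eq_two {x y : V} (hxy : LinearIndependent F ![x, y]) :
    Module.finrank F (Submodule.span F {x, y}) = 2 := by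
  have := finrank_span_eq_card hxy
  rwa [Matrix.range_cons_cons_empty, Fintype.card_fin] at this

theorem Submodule.eq_span_pair {L : Submodule F V} (hL : Module.finrank F L = 2) {x y : V}
    (hxy : LinearIndependent F ![x, y]) (hx : x ∈ L) (hy : y ∈ L) : L = Submodule.span F {x, y} := by
  have : FiniteDimensional F L := Module.finite_of_finrank_eq_succ hL
  refine (Submodule.eq_of_le_of_finrank_eq ?_ ?_).symm
  · exact Submodule.span_le.mpr (Set.insert_subset hx (Set.singleton_subset_iff.mpr hy))
  · rw [finrank_span_pair_eq_two hxy, hL]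

theorem linearIndependent_pair_of_notMem {L : Submodule F V} {x p : V} (hx : x ∈ L) (hx₀ : x ≠ 0)
    (hp : p ∉ L) : LinearIndependent F ![x, p] :=
  (LinearIndependent.pair_iff' hx₀).mpr fun a h => hp (h ▸ L.smul_mem a hx)

theorem exists_dual_eq_zero_iff (hV : Module.finrank F V = 3) {L : Submodule F V}
    (hL : Module.finrank F L = 2) : ∃ φ : V →ₗ[F] F, ∀ x, φ x = 0 ↔ x ∈ L := by
  have hne : L ≠ ⊤ := fun h => by rw [h, finrank_top] at hL; omega
  obtain ⟨φ, hφ, hle⟩ := L.exists_le_ker_of_lt_top (lt_top_iff_ne_top.mpr hne)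
  refine ⟨φ, fun x => ⟨fun hx => ?_, fun hx => hle hx⟩⟩
  by_contra hxL
  exact hφ (LinearMap.ker_eq_top.mp (Submodule.eq_top_of_finrank_two_lt hV hL hle hx hxL))

end SubspaceLemmas

/-! ### Trace of an involution -/

section Involution

variable {F : Type*} [Field F] {σ : F →+* F}

theorem exists_ne_zero_add_conj_eq_zero (hσσ : ∀ x, σ (σ x) = x) (hσ : ∃ x, σ x ≠ x) :
    ∃ u, u ≠ 0 ∧ u + σ u = 0 := by
  obtain ⟨x, hx⟩ := hσ
  exact ⟨x - σ x, sub_ne_zero.mpr hx.symm, by rw [map_sub, hσσ]; ring⟩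

/-- If all traces vanished, the trace of 1 would give `2 = 0`, and then `σ x = -x = x`. This covers
characteristic 2. -/
theorem exists_add_conj_ne_zero (hσ : ∃ x, σ x ≠ x) : ∃ w, w + σ w ≠ 0 := by
  by_contra! h
  obtain ⟨x, hx⟩ := hσ
  have h₁ := h 1
  rw [map_one] at h₁
  exact hx (by linear_combination h x - x * h₁)

theorem exists_add_conj_eq (hσσ : ∀ x, σ (σ x) = x) (hσ : ∃ x, σ x ≠ x) {c : F} (hc : σ c = c) :
    ∃ s, s + σ s = c := by
  obtain ⟨w, hw⟩ := exists_add_conj_ne_zero hσ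
  have hfix : σ (w + σ w) = w + σ w := by rw [map_add, hσσ, add_comm]
  refine ⟨c * w / (w + σ w), ?_⟩
  rw [map_div₀, map_mul, hfix, hc]
  field_simp

end Involution

/-! ### Isotropic vectors of a Hermitian form -/

section HermitianForm

variable {F V : Type*} [Field F] [AddCommGroup V] [Module F V] {σ : F →+* F}

/-- A non-degenerate Hermitian form, with respect to a ring endomorphism `σ`. -/
structure IsHermitianForm (h : V →ₗ[F] V →ₛₗ[σ] F) : Prop where
  symm : ∀ x y, h y x = σ (h x y)
  separating : ∀ x, (∀ y, h x y = 0) → x = 0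

namespace IsHermitianForm

variable {h : V →ₗ[F] V →ₛₗ[σ] F} (hh : IsHermitianForm h)
include hh

theorem eq_zero_symm {x y : V} (hxy : h x y = 0) : h y x = 0 := by rw [hh.symm x y, hxy, map_zero]

theorem exists_apply_ne_zero {x : V} (hx : x ≠ 0) : ∃ y, h x y ≠ 0 := by
  by_contra! H
  exact hx (hh.separating x H)

theorem eq_zero_of_orthogonal (hV : Module.finrank F V = 3) {L : Submodule F V}
    (hL : Module.finrank F L = 2) {p v : V} (hp : p ∉ L) (hvp : h v p = 0)
    (hvL : ∀ y ∈ L, h v y = 0) : v = 0 := by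
  have := Submodule.eq_top_of_finrank_two_lt hV (M := LinearMap.ker (h v)) hL hvL hvp hp
  exact hh.separating v fun y => LinearMap.mem_ker.mp (this ▸ Submodule.mem_top)

/-- Otherwise the span of `x` and `y` is totally isotropic. For `p` outside it, `h y p • x - h x p •
y` is orthogonal to the span and to `p`, hence zero; so `h x p = 0` and `x` is in the radical. -/
theorem apply_ne_zero_of_isotropic (hV : Module.finrank F V = 3) {x y : V}
    (hxy : LinearIndependent F ![x, y]) (hx : h x x = 0) (hy : h y y = 0) : h x y ≠ 0 := by
  intro h₀
  have h₁ := hh.eq_zero_symm h₀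
  have hL := Submodule.finrank_span_pair_eq_two hxy
  have hne : Submodule.span F {x, y} ≠ ⊤ := fun h => by rw [h, finrank_top] at hL; omega
  obtain ⟨p, -, hp⟩ := SetLike.exists_of_lt (lt_top_iff_ne_top.mpr hne)
  have key : h y p • x + (-h x p) • y = 0 := by
    refine hh.eq_zero_of_orthogonal hV hL hp ?_ ?_
    · simp; ring
    · intro z hz
      obtain ⟨a, b, rfl⟩ := Submodule.mem_span_pair.mp hz
      simp [hx, hy, h₀, h₁]
  have hz := (LinearIndependent.pair_iff.mp hxy _ _ key).2
  refine hxy.ne_zero 0 (hh.eq_zero_of_orthogonal hV hL hp (neg_eq_zero.mp hz) ?_)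
  intro z hz
  obtain ⟨a, b, rfl⟩ := Submodule.mem_span_pair.mp hz
  simp [hx, h₀]

theorem apply_self_add_smul (x y : V) (t : F) :
    h (x + t • y) (x + t • y) = h x x + (t * σ (h x y) + σ t * h x y) + t * σ t * h y y := by
  simp [hh.symm x y]; ring

theorem exists_third_isotropic (hσσ : ∀ x, σ (σ x) = x) (hσ : ∃ x, σ x ≠ x) {x y : V}
    (hx : h x x = 0) (hy : h y y = 0) (hxy : h x y ≠ 0) :
    ∃ t : F, t ≠ 0 ∧ h (x + t • y) (x + t • y) = 0 := by
  obtain ⟨u, hu, hu'⟩ := exists_ne_zero_add_conj_eq_zero hσσ hσ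
  have ha : σ (h x y) ≠ 0 := (map_ne_zero σ).mpr hxy
  refine ⟨u / σ (h x y), div_ne_zero hu ha, ?_⟩
  rw [hh.apply_self_add_smul, hx, hy, map_div₀, hσσ, div_mul_cancel₀ _ ha, div_mul_cancel₀ _ hxy,
    hu']
  ring

/-- Every non-tangent line through an isotropic point is secant: isotropy of `v + s • p` prescribes
the trace of `s * h p v`. -/
theorem exists_isotropic_add_smul (hσσ : ∀ x, σ (σ x) = x) (hσ : ∃ x, σ x ≠ x) {p v : V}
    (hp : h p p = 0) (hpv : h p v ≠ 0) : ∃ s : F, h (v + s • p) (v + s • p) = 0 := by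
  obtain ⟨w, hw⟩ := exists_add_conj_eq hσσ hσ (c := -h v v) (by rw [map_neg, ← hh.symm])
  refine ⟨w / h p v, ?_⟩
  rw [hh.apply_self_add_smul, hp, map_div₀, ← hh.symm v p, ← hh.symm p v]
  have hvp : h v p ≠ 0 := by rw [hh.symm p v]; exact (map_ne_zero σ).mpr hpv
  rw [div_mul_cancel₀ _ hpv, div_mul_cancel₀ _ hvp, hw]
  ring

/-- Joining `p` to such a `z` yields a block that misses the given one. Two vectors of the span with
parameters `w` and `w + u`, where `u` has trace zero, share a nonzero value; if both were orthogonal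
to `p`, then so would be `x` and `y`, forcing `p = 0`. -/
theorem exists_anisotropic (hV : Module.finrank F V = 3) (hσσ : ∀ x, σ (σ x) = x)
    (hσ : ∃ x, σ x ≠ x) {x y p : V} (hxy : LinearIndependent F ![x, y]) (hx : h x x = 0)
    (hy : h y y = 0) (hpp : h p p = 0) (hp : p ∉ Submodule.span F {x, y}) :
    ∃ z ∈ Submodule.span F {x, y}, h z z ≠ 0 ∧ h p z ≠ 0 := by
  have hL := Submodule.finrank_span_pair_eq_two hxy
  have ha := hh.apply_ne_zero_of_isotropic hV hxy hx hy
  have ha' : σ (h x y) ≠ 0 := (map_ne_zero σ).mpr ha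
  obtain ⟨u, hu, hu'⟩ := exists_ne_zero_add_conj_eq_zero hσσ hσ
  obtain ⟨w, hw⟩ := exists_add_conj_ne_zero hσ
  have val : ∀ r, h (x + (r / σ (h x y)) • y) (x + (r / σ (h x y)) • y) = r + σ r := by
    intro r
    rw [hh.apply_self_add_smul, hx, hy, map_div₀, hσσ, div_mul_cancel₀ _ ha',
      div_mul_cancel₀ _ ha]
    ring
  have lin : ∀ r, h p (x + (r / σ (h x y)) • y) = h p x + σ r / h x y * h p y := by
    intro r
    simp [hσσ]
  have mem : ∀ r : F, x + r • y ∈ Submodule.span F {x, y} := fun r =>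
    Submodule.mem_span_pair.mpr ⟨1, r, by rw [one_smul]⟩
  by_contra! H
  have h₁ := H _ (mem (w / σ (h x y))) (by rwa [val])
  have h₂ := H _ (mem ((w + u) / σ (h x y)))
    (by rw [val, map_add]; contrapose! hw; linear_combination hw - hu')
  rw [lin] at h₁ h₂
  have hpy : h p y = 0 := by
    have : σ u / h x y * h p y = 0 := by
      rw [map_add] at h₂
      linear_combination h₂ - h₁
    exact (mul_eq_zero.mp this).resolve_left (div_ne_zero ((map_ne_zero σ).mpr hu) ha)
  have hpx : h p x = 0 := by rw [hpy] at h₁; linear_combination h₁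
  refine hp (?_ : p ∈ _)
  rw [hh.eq_zero_of_orthogonal hV hL hp hpp ?_]
  · exact Submodule.zero_mem _
  · intro z hz
    obtain ⟨a, b, rfl⟩ := Submodule.mem_span_pair.mp hz
    simp [hpx, hpy]

theorem exists_isotropic (hV : Module.finrank F V = 3)
    (hN : ∀ c, σ c = c → ∃ t, t * σ t = c) : ∃ x, x ≠ 0 ∧ h x x = 0 := by
  have : FiniteDimensional F V := Module.finite_of_finrank_eq_succ hV
  have : Nontrivial V := Module.nontrivial_of_finrank_pos (R := F) (by omega)
  obtain ⟨x, hx⟩ := exists_ne (0 : V)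
  by_cases hxx : h x x = 0
  · exact ⟨x, hx, hxx⟩
  have hne : Submodule.span F {x} ≠ ⊤ := fun h => by
    have := finrank_span_singleton (K := F) hx
    rw [h, finrank_top] at this
    omega
  obtain ⟨z, -, hz⟩ := SetLike.exists_of_lt (lt_top_iff_ne_top.mpr hne)
  set y := z - (h z x / h x x) • x with hy
  have hy₀ : y ≠ 0 := fun h₀ => hz (Submodule.mem_span_singleton.mpr ⟨_, (sub_eq_zero.mp h₀).symm⟩)
  have hyx : h y x = 0 := by simp [hy, hxx]
  by_cases hyy : h y y = 0
  · exact ⟨y, hy₀, hyy⟩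
  -- As `x` and `y` are orthogonal, `x + t • y` has value `h x x + t * σ t * h y y`.
  obtain ⟨t, ht⟩ := hN (-(h x x / h y y)) (by rw [map_neg, map_div₀, ← hh.symm, ← hh.symm])
  refine ⟨x + t • y, fun h₀ => hxx ?_, ?_⟩
  · have : h (x + t • y) x = 0 := by rw [h₀]; simp
    simpa [hyx] using this
  · rw [hh.apply_self_add_smul, hh.eq_zero_symm hyx, ht]
    simp [hyy]

/-- No four lines in general position meet in six isotropic points. -/
theorem no_onan (hV : Module.finrank F V = 3) {x y z : V} (hxy : LinearIndependent F ![x, y])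
    (hz : z ∉ Submodule.span F {x, y}) (hx : h x x = 0) (hy : h y y = 0) (hzz : h z z = 0)
    (hxy' : h (x - y) (x - y) = 0) (hyz : h (y - z) (y - z) = 0) (hzx : h (z - x) (z - x) = 0) :
    False := by
  simp only [map_sub, LinearMap.sub_apply, hx, hy, hzz] at hxy' hyz hzx
  have e₁ : h y x = - h x y := by linear_combination -hxy'
  have e₂ : h z y = - h y z := by linear_combination -hyz
  have e₃ : h x z = - h z x := by linear_combination -hzx
  have hL := Submodule.finrank_span_pair_eq_two hxy
  -- These coefficients span the kernel direction of an alternating 3 × 3 matrix. By independence `h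
  -- x y = 0`, which is impossible for two isotropic points.
  have key : h y z • x + h z x • y + h x y • z = 0 := by
    refine hh.eq_zero_of_orthogonal hV hL hz ?_ fun w hw => ?_
    · simp [e₃, hzz]; ring
    · obtain ⟨a, b, rfl⟩ := Submodule.mem_span_pair.mp hw
      simp [e₁, e₂, hx, hy]; ring
  by_cases h₀ : h x y = 0
  · exact hh.apply_ne_zero_of_isotropic hV hxy hx hy h₀
  · refine hz (Submodule.mem_span_pair.mpr ⟨-(h y z / h x y), -(h z x / h x y), ?_⟩)
    calc -(h y z / h x y) • x + -(h z x / h x y) • y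
        = (h x y)⁻¹ • -(h y z • x + h z x • y) := by module
      _ = (h x y)⁻¹ • (h x y • z) := by rw [← eq_neg_of_add_eq_zero_right key]
      _ = z := inv_smul_smul₀ h₀ z

end IsHermitianForm
end HermitianForm

/-! ### The involution and norm of a field of square order -/

section FiniteField

variable {F : Type*} [Field F] [Finite F] {q : ℕ}

theorem one_lt_of_card_eq_sq (hq : Nat.card F = q ^ 2) : 1 < q := by
  by_contra! h
  have h₁ : 1 < Nat.card F := Finite.one_lt_card
  rw [hq] at h₁
  interval_cases q <;> omega

theorem exists_ringHom_eq_pow (hq : Nat.card F = q ^ 2) : ∃ σ : F →+* F, ∀ x, σ x = x ^ q := by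
  have : Fintype F := Fintype.ofFinite F
  obtain ⟨p, hp, n, hpp, hn⟩ := FiniteField.card' F
  rw [← Nat.card_eq_fintype_card, hq] at hn
  have : Fact p.Prime := ⟨hpp⟩
  obtain ⟨m, -, rfl⟩ := (Nat.dvd_prime_pow hpp).mp (hn ▸ dvd_pow_self q two_ne_zero)
  exact ⟨iterateFrobenius F p m, fun x => iterateFrobenius_def p m x⟩

theorem pow_card_sqrt_pow (hq : Nat.card F = q ^ 2) (x : F) : (x ^ q) ^ q = x := by
  have : Fintype F := Fintype.ofFinite F
  rw [← pow_mul, ← sq, ← hq, Nat.card_eq_fintype_card, FiniteField.pow_card]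

theorem exists_pow_ne_self (hq : Nat.card F = q ^ 2) : ∃ x : F, x ^ q ≠ x := by
  have h1 := one_lt_of_card_eq_sq hq
  by_contra! h
  have : Fintype F := Fintype.ofFinite F
  have hle : Fintype.card F ≤ q := by
    classical
    rw [← Finset.card_univ, ← FiniteField.X_pow_card_sub_X_natDegree_eq F h1]
    refine Polynomial.card_le_degree_of_subset_roots fun x _ => ?_
    rw [Polynomial.mem_roots (FiniteField.X_pow_card_sub_X_ne_zero F h1)]
    simp [h x]
  rw [← Nat.card_eq_fintype_card, hq] at hle
  nlinarith

/-- Write `c = g ^ k` with `g` a generator of order `(q - 1) * (q + 1)`. From `c ^ (q - 1) = 1` it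
follows that `q + 1` divides `k`. -/
theorem exists_mul_pow_eq (hq : Nat.card F = q ^ 2) {c : F} (hc : c ^ q = c) :
    ∃ t, t * t ^ q = c := by
  have h1 := one_lt_of_card_eq_sq hq
  rcases eq_or_ne c 0 with rfl | hc₀
  · exact ⟨0, zero_mul _⟩
  obtain ⟨g, hg⟩ := IsCyclic.exists_monoid_generator (α := Fˣ)
  obtain ⟨k, hk⟩ := hg (Units.mk0 c hc₀)
  have hord : orderOf g = (q - 1) * (q + 1) := by
    have : orderOf g = Nat.card Fˣ := orderOf_eq_card_of_forall_mem_powers hg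
    rw [this, Nat.card_units, hq]
    obtain ⟨r, rfl⟩ := Nat.exists_eq_add_of_lt h1
    simp; ring_nf; omega
  have hpow : g ^ (k * (q - 1)) = 1 := by
    have hk' : g ^ k = Units.mk0 c hc₀ := hk
    rw [pow_mul, hk']
    ext
    have : c ^ (q - 1) * c = 1 * c := by rw [← pow_succ, Nat.sub_add_cancel h1.le, hc, one_mul]
    simpa using mul_right_cancel₀ hc₀ this
  have hdvd := orderOf_dvd_of_pow_eq_one hpow
  rw [hord, mul_comm k] at hdvd
  obtain ⟨m, rfl⟩ := Nat.dvd_of_mul_dvd_mul_left (by omega) hdvd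
  refine ⟨((g ^ m : Fˣ) : F), ?_⟩
  have : (g ^ ((q + 1) * m) : Fˣ) = Units.mk0 c hc₀ := hk
  calc ((g ^ m : Fˣ) : F) * ((g ^ m : Fˣ) : F) ^ q = ((g ^ ((q + 1) * m) : Fˣ) : F) := by
        push_cast; ring
    _ = c := by rw [this]; rfl

end FiniteField

/-! ### The Hermitian form of a matrix -/

section MatrixForm

variable {F : Type*} [Field F] {q : ℕ} {σ : F →+* F} {A : Matrix (Fin 3) (Fin 3) F}

/-- The sesquilinear form given by a matrix. -/
noncomputable def matrixForm (σ : F →+* F) (A : Matrix (Fin 3) (Fin 3) F) :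
    (Fin 3 → F) →ₗ[F] (Fin 3 → F) →ₛₗ[σ] F :=
  Matrix.toLinearMapₛₗ₂' F (RingHom.id F) σ A

theorem matrixForm_apply (x y : Fin 3 → F) :
    matrixForm σ A x y = ∑ i, ∑ j, x i * A i j * σ (y j) := by
  rw [matrixForm, Matrix.toLinearMapₛₗ₂'_apply]
  refine Finset.sum_congr rfl fun i _ => Finset.sum_congr rfl fun j _ => ?_
  simp only [RingHom.id_apply, smul_eq_mul]
  ring

theorem matrixForm_self (hσ : ∀ x, σ x = x ^ q) (x : Fin 3 → F) :
    matrixForm σ A x x = hermitianValue q A x := by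
  simp only [matrixForm_apply, hermitianValue, hσ]

theorem IsNonsingularHermitian.isHermitianForm (hA : IsNonsingularHermitian q A)
    (hσ : ∀ x, σ x = x ^ q) (hσσ : ∀ x, σ (σ x) = x) : IsHermitianForm (matrixForm σ A) where
  symm x y := by
    have hA' : ∀ i j, σ (A i j) = A j i := fun i j =>
      (hσ _).trans (congrFun (congrFun hA.transpose_eq i) j).symm
    simp only [matrixForm_apply, map_sum, map_mul, hσσ, hA']
    rw [Finset.sum_comm]
    refine Finset.sum_congr rfl fun i _ => Finset.sum_congr rfl fun j _ => ?_
    ring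
  separating x hx := by
    -- Conjugating the second argument turns the sesquilinear form into the bilinear form of `A`.
    refine (Matrix.nondegenerate_of_det_ne_zero hA.det_ne_zero).separatingLeft x fun w => ?_
    rw [← hx fun j => σ (w j), matrixForm_apply]
    simp only [hσσ, dotProduct, Matrix.mulVec, Finset.mul_sum, mul_assoc]
    congr!

end MatrixForm

/-! ### The classical unital has no O'Nan configuration -/

section ClassicalUnital

variable {F : Type*} [Field F] {q : ℕ} {A : Matrix (Fin 3) (Fin 3) F}

theorem finrank_fin_three_fun : Module.finrank F (Fin 3 → F) = 3 := by simp

theorem classicalUnital_inc_iff {p : {p // p ∈ hermitianVariety q A}}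
    {b : {L // IsSecantLine (hermitianVariety q A) L}} :
    (classicalUnital q A).inc p b ↔ p.1.rep ∈ b.1 := by
  change p.1.submodule ≤ b.1 ↔ _
  rw [Projectivization.submodule_eq, Submodule.span_singleton_le_iff_mem]

theorem hermitianValue_rep (p : {p // p ∈ hermitianVariety q A}) :
    hermitianValue q A p.1.rep = 0 :=
  p.2 _ (by rw [Projectivization.submodule_eq]; exact Submodule.mem_span_singleton_self _)

theorem linearIndependent_rep {p r : ℙ F (Fin 3 → F)} (hpr : p ≠ r) :
    LinearIndependent F ![p.rep, r.rep] := by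
  have h := Projectivization.independent_iff.mp
    ((Projectivization.independent_pair_iff_ne p r).mpr hpr)
  have he : Projectivization.rep ∘ ![p, r] = ![p.rep, r.rep] := by
    ext i; fin_cases i <;> rfl
  rwa [he] at h

/-- The point of the unital with a given coordinate vector. -/
def isotropicPoint (x : Fin 3 → F) (hx : x ≠ 0) (hxx : hermitianValue q A x = 0) :
    {p // p ∈ hermitianVariety q A} :=
  ⟨Projectivization.mk F x hx, (mk_mem_hermitianVariety q A x hx).mpr hxx⟩

theorem isotropicPoint_inc_iff {x : Fin 3 → F} {hx : x ≠ 0} {hxx : hermitianValue q A x = 0}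
    {b : {L // IsSecantLine (hermitianVariety q A) L}} :
    (classicalUnital q A).inc (isotropicPoint x hx hxx) b ↔ x ∈ b.1 := by
  change (Projectivization.mk F x hx).submodule ≤ b.1 ↔ _
  rw [Projectivization.submodule_mk, Submodule.span_singleton_le_iff_mem]

theorem ne_isotropicPoint {p : {p // p ∈ hermitianVariety q A}} {x : Fin 3 → F} {hx : x ≠ 0}
    {hxx : hermitianValue q A x = 0} (h : LinearIndependent F ![p.1.rep, x]) :
    p ≠ isotropicPoint x hx hxx := by
  rintro hp
  have h₁ : p.1.submodule = Submodule.span F {x} := by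
    rw [hp]; exact Projectivization.submodule_mk x hx
  rw [Projectivization.submodule_eq] at h₁
  obtain ⟨a, ha⟩ := Submodule.mem_span_singleton.mp (h₁ ▸ Submodule.mem_span_singleton_self x)
  exact (LinearIndependent.pair_iff' p.1.rep_nonzero).mp h a ha

theorem isSecantLine_span_pair {x y : Fin 3 → F} (hxy : LinearIndependent F ![x, y])
    (hx : hermitianValue q A x = 0) (hy : hermitianValue q A y = 0) :
    IsSecantLine (hermitianVariety q A) (Submodule.span F {x, y}) := by
  have hx₀ : x ≠ 0 := hxy.ne_zero 0
  have hy₀ : y ≠ 0 := hxy.ne_zero 1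
  refine ⟨Submodule.finrank_span_pair_eq_two hxy, Projectivization.mk F x hx₀, ⟨?_, ?_⟩,
    Projectivization.mk F y hy₀, ⟨?_, ?_⟩, fun h => ?_⟩
  · change Projectivization.submodule _ ≤ _
    rw [Projectivization.submodule_mk]
    exact Submodule.span_mono (by simp)
  · exact (mk_mem_hermitianVariety q A x hx₀).mpr hx
  · change Projectivization.submodule _ ≤ _
    rw [Projectivization.submodule_mk]
    exact Submodule.span_mono (by simp)
  · exact (mk_mem_hermitianVariety q A y hy₀).mpr hy
  · obtain ⟨a, ha⟩ := (Projectivization.mk_eq_mk_iff' F _ _ hy₀ hx₀).mp h.symm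
    exact (LinearIndependent.pair_iff' hx₀).mp hxy a ha

theorem exists_two_points (b : {L // IsSecantLine (hermitianVariety q A) L}) :
    ∃ p r, (classicalUnital q A).inc p b ∧ (classicalUnital q A).inc r b ∧
      LinearIndependent F ![p.1.rep, r.1.rep] := by
  obtain ⟨p, ⟨hp, hp'⟩, r, ⟨hr, hr'⟩, hpr⟩ := b.2.2
  exact ⟨⟨p, hp'⟩, ⟨r, hr'⟩, hp, hr, linearIndependent_rep hpr⟩

/-- If a line missing the normalized vectors `x` and `y` meets the line `⟨x, y⟩` in an isotropic
point, then this point is `⟨x - y⟩`. -/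
theorem isotropic_sub_of_mem_ker {σ : F →+* F} {V : Type*} [AddCommGroup V] [Module F V]
    (h : V →ₗ[F] V →ₛₗ[σ] F) (φ : V →ₗ[F] F) {x y w : V} (hx : φ x = 1) (hy : φ y = 1)
    (hw : w ∈ Submodule.span F {x, y}) (hw₀ : w ≠ 0) (hφ : φ w = 0) (hww : h w w = 0) :
    h (x - y) (x - y) = 0 := by
  obtain ⟨a, b, rfl⟩ := Submodule.mem_span_pair.mp hw
  have hb : b = -a := by
    simp only [map_add, map_smul, hx, hy, smul_eq_mul, mul_one] at hφ
    linear_combination hφ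
  have he : a • x + b • y = a • (x - y) := by rw [hb]; module
  rw [he] at hww hw₀
  have ha : a ≠ 0 := fun h => hw₀ (by rw [h, zero_smul])
  rw [map_smulₛₗ, map_smul, LinearMap.smul_apply, smul_eq_mul, smul_eq_mul] at hww
  exact ((mul_eq_zero.mp hww).resolve_left ((map_ne_zero σ).mpr ha) |> mul_eq_zero.mp).resolve_left ha

variable {σ : F →+* F}

theorem IsNonsingularHermitian.isONanFree (hA : IsNonsingularHermitian q A)
    (hσq : ∀ x, σ x = x ^ q) (hσσ : ∀ x, σ (σ x) = x) (hσ : ∃ x, σ x ≠ x)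
    (hN : ∀ c, σ c = c → ∃ t, t * σ t = c) : (classicalUnital q A).IsONanFree := by
  have hh := hA.isHermitianForm hσq hσσ
  have hV := finrank_fin_three_fun (F := F)
  have val := matrixForm_self (A := A) hσq
  have rep₀ : ∀ p : {p // p ∈ hermitianVariety q A}, matrixForm σ A p.1.rep p.1.rep = 0 :=
    fun p => (val _).trans (hermitianValue_rep p)
  constructor
  case exists_join =>
    intro p r hpr
    refine ⟨⟨_, isSecantLine_span_pair (linearIndependent_rep fun h => hpr (Subtype.ext h))
      (hermitianValue_rep p) (hermitianValue_rep r)⟩, ?_, ?_⟩ <;>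
    exact classicalUnital_inc_iff.mpr (Submodule.subset_span (by simp))
  case eq_of_inc =>
    intro p r b c hpr hpb hrb hpc hrc
    rw [classicalUnital_inc_iff] at hpb hrb hpc hrc
    have hli := linearIndependent_rep fun h => hpr (Subtype.ext h)
    exact Subtype.ext ((Submodule.eq_span_pair b.2.1 hli hpb hrb).trans
      (Submodule.eq_span_pair c.2.1 hli hpc hrc).symm)
  case three_points =>
    intro b
    obtain ⟨p, r, hp, hr, hli⟩ := exists_two_points b
    obtain ⟨t, ht, htt⟩ := hh.exists_third_isotropic hσσ hσ (rep₀ p) (rep₀ r)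
      (hh.apply_ne_zero_of_isotropic hV hli (rep₀ p) (rep₀ r))
    have hli' := LinearIndependent.pair_iff.mp hli
    have h₁ : LinearIndependent F ![p.1.rep, p.1.rep + t • r.1.rep] :=
      LinearIndependent.pair_iff.mpr fun a c hac => by
        obtain ⟨e₁, e₂⟩ := hli' (a + c) (c * t) (by rw [← hac]; module)
        have hc := (mul_eq_zero.mp e₂).resolve_right ht
        exact ⟨by rwa [hc, add_zero] at e₁, hc⟩
    have h₂ : LinearIndependent F ![r.1.rep, p.1.rep + t • r.1.rep] :=
      LinearIndependent.pair_iff.mpr fun a c hac => by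
        obtain ⟨e₁, e₂⟩ := hli' c (a + c * t) (by rw [← hac]; module)
        exact ⟨by rwa [e₁, zero_mul, add_zero] at e₂, e₁⟩
    refine ⟨p, r, isotropicPoint _ (h₁.ne_zero 1) ((val _).symm.trans htt), hp, hr, ?_, ?_,
      ne_isotropicPoint h₁, ne_isotropicPoint h₂⟩
    · exact isotropicPoint_inc_iff.mpr (b.1.add_mem (classicalUnital_inc_iff.mp hp)
        (b.1.smul_mem t (classicalUnital_inc_iff.mp hr)))
    · rintro rfl
      have := hli' 1 (-1) (by module)
      exact one_ne_zero this.1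
  case exists_not_meet =>
    intro p b hpb
    rw [classicalUnital_inc_iff] at hpb
    obtain ⟨r, s, hr, hs, hli⟩ := exists_two_points b
    rw [classicalUnital_inc_iff] at hr hs
    have hb := Submodule.eq_span_pair b.2.1 hli hr hs
    obtain ⟨z, hz, hzz, hpz⟩ := hh.exists_anisotropic hV hσσ hσ hli (rep₀ r) (rep₀ s) (rep₀ p)
      (hb ▸ hpb)
    rw [← hb] at hz
    obtain ⟨t, ht⟩ := hh.exists_isotropic_add_smul hσσ hσ (rep₀ p) hpz
    have hli₂ : LinearIndependent F ![p.1.rep, z + t • p.1.rep] := by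
      refine (LinearIndependent.pair_iff' p.1.rep_nonzero).mpr fun a ha => hpz ?_
      have : z = (a - t) • p.1.rep := by rw [sub_smul, ha]; module
      rw [this, map_smulₛₗ, rep₀, smul_zero]
    refine ⟨⟨_, isSecantLine_span_pair hli₂ (hermitianValue_rep p) ((val _).symm.trans ht)⟩,
      classicalUnital_inc_iff.mpr (Submodule.subset_span (by simp)), ?_⟩
    rintro ⟨v, hvc, hvb⟩
    rw [classicalUnital_inc_iff] at hvc hvb
    obtain ⟨a, c, hac⟩ := Submodule.mem_span_pair.mp hvc
    -- A common point has no `p`-component, since `v` and `z` lie in `b` and `p` does not; so it is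
    -- `z`, which is anisotropic.
    have hv : v.1.rep = (a + c * t) • p.1.rep + c • z := by rw [← hac]; module
    have h₀ : a + c * t = 0 := by
      by_contra hne
      refine hpb ((Submodule.smul_mem_iff _ hne).mp ?_)
      rw [← add_sub_cancel_right ((a + c * t) • p.1.rep) (c • z), ← hv]
      exact b.1.sub_mem hvb (b.1.smul_mem c hz)
    rw [h₀, zero_smul, zero_add] at hv
    have hc : c ≠ 0 := fun h => v.1.rep_nonzero (by rw [hv, h, zero_smul])
    have := rep₀ v
    rw [hv] at this
    simp [hc, hzz] at this
  case exists_not_inc =>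
    obtain ⟨p, hp, hpp⟩ := hh.exists_isotropic hV hN
    obtain ⟨v, hv⟩ := hh.exists_apply_ne_zero hp
    obtain ⟨t, ht⟩ := hh.exists_isotropic_add_smul hσσ hσ hpp hv
    have hpv : matrixForm σ A p (v + t • p) ≠ 0 := by simpa [hpp] using hv
    generalize v + t • p = r at ht hpv
    have hli : LinearIndependent F ![p, r] := by
      refine (LinearIndependent.pair_iff' hp).mpr fun a ha => hpv ?_
      rw [← ha, map_smulₛₗ, hpp, smul_zero]
    have hL := Submodule.finrank_span_pair_eq_two hli
    have hne : Submodule.span F {p, r} ≠ ⊤ := fun h => by rw [h, finrank_top] at hL; omega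
    have hmp : p ∈ Submodule.span F {p, r} := Submodule.subset_span (by simp)
    have hmr : r ∈ Submodule.span F {p, r} := Submodule.subset_span (by simp)
    obtain ⟨w, hw, hpw⟩ : ∃ w ∉ Submodule.span F {p, r}, matrixForm σ A p w ≠ 0 := by
      obtain ⟨w, -, hw⟩ := SetLike.exists_of_lt (lt_top_iff_ne_top.mpr hne)
      by_cases hpw : matrixForm σ A p w = 0
      -- If `w` is orthogonal to `p`, adding `r` repairs this without entering the plane, because `h
      -- p r ≠ 0`.
      · exact ⟨r + w, fun h => hw ((Submodule.add_mem_iff_right _ hmr).mp h), by simpa [hpw]⟩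
      · exact ⟨w, hw, hpw⟩
    obtain ⟨s, hs⟩ := hh.exists_isotropic_add_smul hσσ hσ hpp hpw
    have hws : w + s • p ∉ Submodule.span F {p, r} := fun h =>
      hw ((Submodule.add_mem_iff_left _ (Submodule.smul_mem _ s hmp)).mp h)
    refine ⟨isotropicPoint (w + s • p) (fun h => hws (h ▸ Submodule.zero_mem _))
        ((val _).symm.trans hs),
      ⟨_, isSecantLine_span_pair hli ((val _).symm.trans hpp) ((val _).symm.trans ht)⟩, fun h => ?_⟩
    exact hws (isotropicPoint_inc_iff.mp h)
  case no_onan =>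
    intro b₁ b₂ b₃ b₄ p₁₂ p₁₃ p₂₃ i₁ i₂ i₃ i₄ i₅ i₆ i₇ i₈ i₉ ⟨r, hr₁, hr⟩ ⟨s, hs₂, hs⟩ ⟨t, ht₃, ht⟩
    obtain ⟨φ, hφ⟩ := exists_dual_eq_zero_iff hV b₄.2.1
    simp only [classicalUnital_inc_iff] at *
    by_contra! H
    obtain ⟨hz, hy, hx⟩ := H
    -- Scaling the three vertices to `φ = 1` makes the intersection of each side with `b₄` the
    -- difference of two vertex vectors.
    have normalize : ∀ p : {p // p ∈ hermitianVariety q A}, p.1.rep ∉ b₄.1 →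
        ∃ x, φ x = 1 ∧ matrixForm σ A x x = 0 ∧ ∀ L : Submodule F (Fin 3 → F),
          x ∈ L ↔ p.1.rep ∈ L := by
      intro p hp
      have hp' : φ p.1.rep ≠ 0 := fun h => hp ((hφ _).mp h)
      refine ⟨(φ p.1.rep)⁻¹ • p.1.rep, ?_, ?_, fun L => L.smul_mem_iff (inv_ne_zero hp')⟩
      · rw [map_smul, smul_eq_mul, inv_mul_cancel₀ hp']
      · simp [rep₀ p]
    obtain ⟨x, hx₁, hxx, hxL⟩ := normalize _ hx
    obtain ⟨y, hy₁, hyy, hyL⟩ := normalize _ hy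
    obtain ⟨z, hz₁, hzz, hzL⟩ := normalize _ hz
    simp only [← hxL, ← hyL, ← hzL] at *
    have ne : ∀ {x}, φ x = 1 → x ≠ 0 := by
      rintro x hx rfl
      rw [map_zero] at hx
      exact zero_ne_one hx
    have lxy := linearIndependent_pair_of_notMem i₇ (ne hx₁) i₆
    have lyz := linearIndependent_pair_of_notMem i₅ (ne hy₁) i₃
    have lzx := linearIndependent_pair_of_notMem i₁ (ne hz₁) i₉
    have e₁ := Submodule.eq_span_pair b₁.2.1 lyz i₄ i₁
    have e₂ := Submodule.eq_span_pair b₂.2.1 lzx i₂ i₇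
    have e₃ := Submodule.eq_span_pair b₃.2.1 lxy i₈ i₅
    exact hh.no_onan hV lxy (e₃ ▸ i₃) hxx hyy hzz
      (isotropic_sub_of_mem_ker _ φ hx₁ hy₁ (e₃ ▸ ht₃) t.1.rep_nonzero ((hφ _).mpr ht) (rep₀ t))
      (isotropic_sub_of_mem_ker _ φ hy₁ hz₁ (e₁ ▸ hr₁) r.1.rep_nonzero ((hφ _).mpr hr) (rep₀ r))
      (isotropic_sub_of_mem_ker _ φ hz₁ hx₁ (e₂ ▸ hs₂) s.1.rep_nonzero ((hφ _).mpr hs) (rep₀ s))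

end ClassicalUnital

theorem mainTheorem6 {F : Type*} [Field F] [Finite F] (q : ℕ) (hq : Nat.card F = q ^ 2)
    (A : Matrix (Fin 3) (Fin 3) F) (hA : IsNonsingularHermitian q A) :
    (∀ S : Set {L // IsSecantLine (hermitianVariety q A) L},
      (classicalUnital q A).IsMaximalEKR S ↔
        ((classicalUnital q A).IsPointPencil S ∨ (classicalUnital q A).IsTriangle S)) ∧
    (∃ S, (classicalUnital q A).IsPointPencil S) ∧
    (∃ S, (classicalUnital q A).IsTriangle S) ∧
    (∀ S, ¬ ((classicalUnital q A).IsPointPencil S ∧ (classicalUnital q A).IsTriangle S)) := by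
  obtain ⟨σ, hσ⟩ := exists_ringHom_eq_pow hq
  have hU := hA.isONanFree hσ (fun x => by rw [hσ, hσ, pow_card_sqrt_pow hq])
    ((exists_pow_ne_self hq).imp fun x hx => by rwa [hσ])
    (fun c hc => (exists_mul_pow_eq hq ((hσ c).symm.trans hc)).imp fun t ht => by rwa [hσ])
  exact ⟨fun S => hU.isMaximalEKR_iff, hU.exists_isPointPencil, hU.exists_isTriangle,
    hU.not_isPointPencil_and_isTriangle⟩
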